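/- Let $P_1,\dots,P_8\in\mathbb{P}^2(\mathbb{C})$ be distinct points in general position: no three of them lie on a line, no six of them lie on a conic, and no cubic through all eight of them is singular at one of them. Let $f\colon\mathbb{S}_8\to\mathbb{P}^2$ be the blow-up of $P_1,\dots,P_8$ with exceptional curves $E_1,\dots,E_8$, let $H$ be the pull-back of a line, and put $L=3H-E_1-\dots-E_8$. For a set $Z\subset\mathbb{S}_8$ of closed points and an integer $m\ge 1$ let $$\alpha(mZ)=\min\{d\ge 0:\ \text{there is a nonzero } s\in H^0(\mathbb{S}_8,dL)\text{ with } \operatorname{mult}_Q(s)\ge m\text{ for all }Q\in Z\}$$ (and $\alpha(mZ)=\infty$ if there is no such $d$). Then, for every $Z\subset\mathbb{S}_8$, the equalities $\alpha(Z)=\alpha(2Z)=1$ hold if and only if $Z=\{Q\}$ for a point $Q$ such that $f(Q)$ is the (unique) singular point of an irreducible plane cubic passing through $P_1,\dots,P_8$, and $f(Q)\ne P_i$ for $i=1,\dots,8$. Moreover, such a point $Q$ always exists: there is an irreducible plane cubic through $P_1,\dots,P_8$ with a unique singular point, and that point is distinct from all the $P_i$. -/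

import Mathlib

open scoped LinearAlgebra.Projectivization

namespace DelPezzo

/-- Homogeneous coordinate vectors of the complex projective plane. -/
abbrev Vec : Type := Fin 3 → ℂ

/-- The complex projective plane. A point `ℓ` of `Plane` also stands for the line
`ℓ₀ x₀ + ℓ₁ x₁ + ℓ₂ x₂ = 0`, so that `Projectivization.orthogonal x ℓ` says that the point `x`
lies on the line `ℓ`. -/
abbrev Plane : Type := ℙ ℂ Vec

/-- Polynomials in the homogeneous coordinates of the plane. -/
abbrev Form : Type := MvPolynomial (Fin 3) ℂ

/-- The curve `F = 0` passes through the point `x`. -/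
def VanishesAt (F : Form) (x : Plane) : Prop :=
  MvPolynomial.eval x.rep F = 0

/-- The point `x` is a singular point of the curve `F = 0`. -/
def IsSingularAt (F : Form) (x : Plane) : Prop :=
  VanishesAt F x ∧ ∀ j, VanishesAt (MvPolynomial.pderiv j F) x

/-- The set of singular points of the plane curve `F = 0`. -/
def singularPoints (F : Form) : Set Plane := {x | IsSingularAt F x}

/-- Eight points of the plane in general position: they are distinct, no three of them lie on a
line, no six of them lie on a conic (possibly degenerate), and no cubic through all eight is
singular at one of them. -/
structure GeneralPosition (P : Fin 8 → Plane) : Prop where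
  injective : Function.Injective P
  no_three_on_line : ∀ s : Finset (Fin 8), s.card = 3 →
    ¬ ∃ F : Form, F ≠ 0 ∧ F.IsHomogeneous 1 ∧ ∀ i ∈ s, VanishesAt F (P i)
  no_six_on_conic : ∀ s : Finset (Fin 8), s.card = 6 →
    ¬ ∃ F : Form, F ≠ 0 ∧ F.IsHomogeneous 2 ∧ ∀ i ∈ s, VanishesAt F (P i)
  no_cubic_singular_at : ∀ i : Fin 8,
    ¬ ∃ F : Form, F ≠ 0 ∧ F.IsHomogeneous 3 ∧ (∀ j, VanishesAt F (P j)) ∧ IsSingularAt F (P i)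

/-- The blow-up of the plane at the points `P i` (assumed distinct), as the incidence variety in
`ℙ² × (ℙ²ᵛ)ʳ` of tuples `(x, ℓ₁, …, ℓᵣ)` where `ℓᵢ` is a line through `P i` and `x`; that is, the
fibre product over the plane of the closures of the graphs of the projections from the `P i`.
The elements are the closed points of the surface. -/
@[ext]
structure BlowUp {r : ℕ} (P : Fin r → Plane) where
  /-- The image of the point under the blow-down morphism `f`. -/
  f : Plane
  /-- The line through `P i` and `f`; a tangent direction at `P i` if `f = P i`. -/
  line : Fin r → Plane
  center_mem_line : ∀ i, Projectivization.orthogonal (P i) (line i)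
  f_mem_line : ∀ i, Projectivization.orthogonal f (line i)

namespace BlowUp

variable {r : ℕ} {P : Fin r → Plane}

/-- The exceptional curve `Eᵢ` over `P i`. -/
def E (P : Fin r → Plane) (i : Fin r) : Set (BlowUp P) := {Q | Q.f = P i}

/-- The point `Q` lies on `E₁ ∪ … ∪ Eᵣ`. -/
def IsExceptional (Q : BlowUp P) : Prop := ∃ i, Q ∈ E P i

/-- A frame at `Q`: a basis `p, a, b` of `ℂ³` such that `p` represents `f Q` and, if `Q` lies on
`Eᵢ`, the vector `a` spans together with `p` the line through `P i` given by `Q`.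
It defines an affine chart `(u, v)` of the blow-up, centred at `Q`, in which the blow-down is
* `(u, v) ↦ [p + u a + v b]` if `Q` lies on no exceptional curve;
* `(u, v) ↦ [p + u (a + v b)]` if `Q` lies on an exceptional curve, which then is `u = 0`. -/
structure Frame (Q : BlowUp P) where
  p : Vec
  a : Vec
  b : Vec
  linearIndependent : LinearIndependent ℂ ![p, a, b]
  mk_p : Projectivization.mk ℂ p (linearIndependent.ne_zero 0) = Q.f
  a_mem_line : ∀ i, Q ∈ E P i → (Q.line i).rep ⬝ᵥ a = 0

namespace Frame

variable {Q : BlowUp P}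

open Classical in
/-- The blow-down morphism in the chart of the frame, in homogeneous coordinates. -/
noncomputable def chart (κ : Frame Q) (j : Fin 3) : MvPolynomial (Fin 2) ℂ :=
  if Q.IsExceptional then
    .C (κ.p j) + .X 0 * (.C (κ.a j) + .X 1 * .C (κ.b j))
  else
    .C (κ.p j) + .X 0 * .C (κ.a j) + .X 1 * .C (κ.b j)

open Classical in
/-- A local equation at `Q` of the divisor `E₁ + … + Eᵣ` in the chart of the frame. -/
noncomputable def excEq (_κ : Frame Q) : MvPolynomial (Fin 2) ℂ :=
  if Q.IsExceptional then .X 0 else 1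

/-- The local equation at `Q` of the pull-back of the plane curve `F = 0`. -/
noncomputable def pullback (κ : Frame Q) : Form →ₐ[ℂ] MvPolynomial (Fin 2) ℂ :=
  MvPolynomial.aeval κ.chart

/-- The maximal ideal `(u, v)` of the point `Q` in the chart of the frame. -/
noncomputable def maxIdeal (_κ : Frame Q) : Ideal (MvPolynomial (Fin 2) ℂ) :=
  Ideal.span {.X 0, .X 1}

end Frame

/-- Every point of the blow-up has a frame. -/
theorem Frame.nonempty (hP : Function.Injective P) (Q : BlowUp P) : Nonempty (Frame Q) := by
  obtain ⟨ℓ, hℓ, hE⟩ : ∃ ℓ : Plane, Projectivization.orthogonal Q.f ℓ ∧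
      ∀ i, Q ∈ E P i → Q.line i = ℓ := by
    by_cases h : Q.IsExceptional
    · obtain ⟨i, hi⟩ := h
      refine ⟨Q.line i, Q.f_mem_line i, fun j hj => ?_⟩
      have : j = i := hP (hj.symm.trans hi)
      rw [this]
    · have h0 : ∃ w : Vec, w ≠ 0 ∧ Q.f.rep ⬝ᵥ w = 0 := by
        by_cases h1 : Q.f.rep 0 = 0
        · refine ⟨![1, 0, 0], fun h => ?_, by simp [dotProduct, Fin.sum_univ_three, h1]⟩
          simpa using congrFun h 0
        · refine ⟨![-Q.f.rep 1, Q.f.rep 0, 0], fun h => h1 ?_, ?_⟩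
          · simpa using congrFun h 1
          · simp [dotProduct, Fin.sum_univ_three]; ring
      obtain ⟨w, hw, hpw⟩ := h0
      refine ⟨Projectivization.mk ℂ w hw, ?_, fun i hi => (h ⟨i, hi⟩).elim⟩
      rw [← Q.f.mk_rep]
      exact hpw
  set p := Q.f.rep with hp
  have hp0 : p ≠ 0 := Q.f.rep_nonzero
  have hpl : ℓ.rep ⬝ᵥ p = 0 := by
    rw [← Q.f.mk_rep, ← ℓ.mk_rep, Projectivization.orthogonal_mk, dotProduct_comm] at hℓ
    exact hℓ
  let φ : Vec →ₗ[ℂ] ℂ := dotProductBilin ℂ ℂ ℓ.rep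
  have hker : 2 ≤ Module.finrank ℂ (LinearMap.ker φ) := by
    have h1 := φ.finrank_range_add_finrank_ker
    have h2 : Module.finrank ℂ (LinearMap.range φ) ≤ 1 := by
      simpa using Submodule.finrank_le (LinearMap.range φ)
    simp at h1
    omega
  obtain ⟨a, ha, hpa⟩ : ∃ a ∈ LinearMap.ker φ, a ∉ Submodule.span ℂ {p} := by
    by_contra! h
    have h1 := Submodule.finrank_mono (show LinearMap.ker φ ≤ Submodule.span ℂ {p} from h)
    rw [finrank_span_singleton hp0] at h1
    omega
  obtain ⟨b, hb⟩ : ∃ b : Vec, b ∉ Submodule.span ℂ (Set.range ![p, a]) := by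
    by_contra! h
    have h1 : Submodule.span ℂ (Set.range ![p, a]) = ⊤ := (Submodule.eq_top_iff').2 h
    have h2 := finrank_range_le_card (R := ℂ) ![p, a]
    rw [Set.finrank, h1] at h2
    simp at h2
  have hpa' : LinearIndependent ℂ ![p, a] := by
    rw [LinearIndependent.pair_iff' hp0]
    intro c hc
    exact hpa (Submodule.mem_span_singleton.2 ⟨c, hc⟩)
  have hli : LinearIndependent ℂ ![p, a, b] := by
    have h1 := linearIndependent_finSnoc.2 ⟨hpa', hb⟩
    have h2 : (Fin.snoc ![p, a] b : Fin 3 → Vec) = ![p, a, b] := by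
      ext i : 1
      fin_cases i <;> rfl
    rw [← h2]
    exact h1
  refine ⟨⟨p, a, b, hli, Q.f.mk_rep, fun i hi => ?_⟩⟩
  rw [hE i hi]
  exact ha

/-- The space `H⁰(𝕊, d L)` for `L = 3 H - E₁ - … - Eᵣ`, realised inside
`H⁰(𝕊, 3 d H)`, the space of pull-backs of plane forms of degree `3 d`, as the subspace of those
pull-backs that vanish to order at least `d` along every exceptional curve. -/
noncomputable def sections (P : Fin r → Plane) (d : ℕ) : Submodule ℂ Form where
  carrier := {F | F.IsHomogeneous (3 * d) ∧
    ∀ (Q : BlowUp P) (κ : Frame Q), κ.excEq ^ d ∣ κ.pullback F}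
  zero_mem' := ⟨MvPolynomial.isHomogeneous_zero _ _ _, fun Q κ => by simp⟩
  add_mem' := fun hF hG => ⟨hF.1.add hG.1, fun Q κ => by
    rw [map_add]; exact dvd_add (hF.2 Q κ) (hG.2 Q κ)⟩
  smul_mem' := fun c F hF => ⟨(MvPolynomial.homogeneousSubmodule _ _ _).smul_mem c hF.1,
    fun Q κ => by rw [map_smul]; exact dvd_smul_of_dvd c (hF.2 Q κ)⟩

/-- The section of `d L` given by the form `F` has multiplicity at least `m` at `Q`: its local
equation `g`, which is that of the pull-back of `F` divided by the `d`-th power of the local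
equation of `E₁ + … + Eᵣ`, lies in the `m`-th power of the maximal ideal of `Q`. -/
def MultGE (d m : ℕ) (Q : BlowUp P) (F : Form) : Prop :=
  ∀ κ : Frame Q, ∃ g ∈ κ.maxIdeal ^ m, κ.pullback F = κ.excEq ^ d * g

/-- The space `H⁰(𝕊, d L ⊗ I_Z^(m))` of the sections of `d L` that have multiplicity at least `m`
at every point of `Z`. -/
noncomputable def fatSections (Z : Set (BlowUp P)) (d m : ℕ) : Submodule ℂ Form where
  carrier := {F | F ∈ sections P d ∧ ∀ Q ∈ Z, MultGE d m Q F}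
  zero_mem' := ⟨zero_mem _, fun Q _ κ => ⟨0, zero_mem _, by simp⟩⟩
  add_mem' := fun hF hG => ⟨add_mem hF.1 hG.1, fun Q hQ κ => by
    obtain ⟨g, hg, h⟩ := hF.2 Q hQ κ
    obtain ⟨g', hg', h'⟩ := hG.2 Q hQ κ
    exact ⟨g + g', add_mem hg hg', by rw [map_add, h, h', mul_add]⟩⟩
  smul_mem' := fun c F hF => ⟨Submodule.smul_mem _ c hF.1, fun Q hQ κ => by
    obtain ⟨g, hg, h⟩ := hF.2 Q hQ κ
    exact ⟨c • g, Submodule.smul_of_tower_mem _ c hg, by rw [map_smul, h, mul_smul_comm]⟩⟩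

/-- The initial degree `α(m Z)` with respect to `L = 3 H - E₁ - … - Eᵣ`: the least `d` with
`H⁰(𝕊, d L ⊗ I_Z^(m)) ≠ 0` (and `⊤` if there is no such `d`). -/
noncomputable def alpha (m : ℕ) (Z : Set (BlowUp P)) : ℕ∞ :=
  sInf {n : ℕ∞ | ∃ d : ℕ, n = d ∧ fatSections Z d m ≠ ⊥}

end BlowUp

end DelPezzo

/-!
By definition `α(Z) = α(2Z) = 1` says that `Z` is nonempty (a nonzero constant has no zeros) and
that some nonzero section of `L`, that is, some nonzero cubic `F` through the eight points, has
multiplicity at least two at every point of `Z`.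

Such a cubic is irreducible: otherwise it is the product of a linear and a quadratic form, and a
line contains at most two and a conic at most five of the points (`GeneralPosition.irreducible`).
An irreducible cubic has at most one singular point, for it would contain the line through two of
them (`eq_of_isSingularAt`). A section has multiplicity two at a point `Q` off the exceptional
curves if and only if `F` is singular at `f Q`. At a point of `Eᵢ` multiplicity two forces `F` to
be singular at `P i`, because the restriction of the section to `Eᵢ` is the differential of `F` at
`P i`; this is excluded by general position (`isSingularAt_of_multGE_two`,
`multGE_two_of_isSingularAt`). Hence `Z` has exactly one point, and it lies over the singular
point of `F`.

For the existence of a singular member in the pencil of cubics through the points, take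
coordinates with `P 0 = (1 : 0 : 0)` and write a cubic of the pencil as `x² L + x Q + K` with
binary forms `L`, `Q`, `K` in `y, z`. The zeros of the quartic `Q² - 4 L K` are the directions of
the tangent lines from `P 0`. Its discriminant is a form of degree twelve in the parameters of the
pencil, hence vanishes for some member (`exists_tangentDiscr_eq_zero`). A double root of the
quartic gives a singular point of that member, or a line through `P 0` contained in it
(`exists_singular_or_line`), and the latter contradicts irreducibility.
-/

/-! ### Partial derivatives and homogeneous polynomials -/

namespace MvPolynomial

/-- The chain rule for partial derivatives. -/
theorem pderiv_aeval_eq_sum {σ τ R : Type*} [Fintype σ] [CommRing R]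
    (g : σ → MvPolynomial τ R) (i : τ) (F : MvPolynomial σ R) :
    pderiv i (aeval g F) = ∑ j, aeval g (pderiv j F) * pderiv i (g j) := by
  classical
  induction F using MvPolynomial.induction_on with
  | C r => simp [algebraMap_eq]
  | add p q hp hq => simp only [map_add, hp, hq, add_mul, Finset.sum_add_distrib]
  | mul_X p k hp =>
    simp only [map_mul, aeval_X, Derivation.leibniz, smul_eq_mul, hp, pderiv_X, map_add, add_mul,
      Finset.sum_add_distrib, Finset.mul_sum]
    congr 1
    · rw [Finset.sum_eq_single k]
      · simp
      · intro j _ hj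
        simp [Pi.single_eq_of_ne' hj]
      · simp
    · exact Finset.sum_congr rfl fun j _ => by ring

/-- Taylor's formula to first order: the remainder lies in the square of any ideal that contains
the increments. -/
theorem aeval_add_sub_mem_sq {σ R A : Type*} [Fintype σ] [CommRing R] [CommRing A] [Algebra R A]
    (I : Ideal A) (p h : σ → A) (hh : ∀ j, h j ∈ I) (F : MvPolynomial σ R) :
    aeval (fun j => p j + h j) F - (aeval p F + ∑ j, h j * aeval p (pderiv j F)) ∈ I ^ 2 := by
  classical
  induction F using MvPolynomial.induction_on with
  | C r => simp
  | add F G hF hG =>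
    convert add_mem hF hG using 1
    simp only [map_add, mul_add, Finset.sum_add_distrib]
    ring
  | mul_X F k hF =>
    have hsum : ∑ j, h j * aeval p (pderiv j F) ∈ I :=
      I.sum_mem fun j _ => I.mul_mem_right _ (hh j)
    have h2 : h k * ∑ j, h j * aeval p (pderiv j F) ∈ I ^ 2 := by
      rw [pow_two]; exact Ideal.mul_mem_mul (hh k) hsum
    have h3 : ∑ j, h j * aeval p (pderiv j (F * X k)) =
        p k * ∑ j, h j * aeval p (pderiv j F) + h k * aeval p F := by
      simp only [Derivation.leibniz, smul_eq_mul, pderiv_X, map_add, map_mul, aeval_X, mul_add,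
        Finset.sum_add_distrib, Finset.mul_sum]
      rw [add_comm]
      congr 1
      · exact Finset.sum_congr rfl fun j _ => by ring
      · rw [Finset.sum_eq_single k]
        · simp
        · intro j _ hj
          simp [Pi.single_eq_of_ne' hj]
        · simp
    convert add_mem (Ideal.mul_mem_left _ (p k + h k) hF) h2 using 1
    rw [h3]
    simp only [map_mul, aeval_X]
    ring

/-- A polynomial in the square of the maximal ideal of the origin has no terms of order at most
one. -/
theorem eval_eq_zero_of_mem_sq {g : MvPolynomial (Fin 2) ℂ}
    (hg : g ∈ (Ideal.span {X 0, X 1} : Ideal (MvPolynomial (Fin 2) ℂ)) ^ 2) :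
    eval 0 g = 0 ∧ ∀ i, eval 0 (pderiv i g) = 0 := by
  have h1 : ∀ a ∈ (Ideal.span {X 0, X 1} : Ideal (MvPolynomial (Fin 2) ℂ)), eval 0 a = 0 := by
    intro a ha
    obtain ⟨x, y, rfl⟩ := Ideal.mem_span_pair.1 ha
    simp
  rw [pow_two] at hg
  induction hg using Submodule.mul_induction_on' with
  | mem_mul_mem a ha b hb =>
    simp only [map_mul, Derivation.leibniz, smul_eq_mul, map_add, h1 a ha, h1 b hb, zero_mul,
      add_zero, implies_true, and_self]
  | add a _ b _ iha ihb =>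
    simp only [map_add, iha.1, ihb.1, iha.2, ihb.2, add_zero, implies_true, and_self]

/-- A form that is a product is the product of the leading forms of the factors. -/
theorem IsHomogeneous.eq_mul_homogeneousComponent {σ R : Type*} [CommRing R] [IsDomain R]
    {n : ℕ} {A B : MvPolynomial σ R} (h : (A * B).IsHomogeneous n) (h0 : A * B ≠ 0) :
    A.totalDegree + B.totalDegree = n ∧
      A * B = homogeneousComponent A.totalDegree A * homogeneousComponent B.totalDegree B := by
  have hdeg : A.totalDegree + B.totalDegree = n := by
    rw [← totalDegree_mul_of_isDomain (left_ne_zero_of_mul h0) (right_ne_zero_of_mul h0),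
      h.totalDegree h0]
  refine ⟨hdeg, ?_⟩
  have hcomp : ∀ i j,
      homogeneousComponent n (homogeneousComponent i A * homogeneousComponent j B) =
      if i + j = n then homogeneousComponent i A * homogeneousComponent j B else 0 := by
    intro i j
    rw [homogeneousComponent_of_mem
      (((homogeneousComponent_isHomogeneous i A).mul (homogeneousComponent_isHomogeneous j B)))]
    simp [eq_comm]
  have hAB : A * B = ∑ i ∈ Finset.range (A.totalDegree + 1),
      ∑ j ∈ Finset.range (B.totalDegree + 1),
        homogeneousComponent i A * homogeneousComponent j B := by
    rw [← Finset.sum_mul_sum, sum_homogeneousComponent, sum_homogeneousComponent]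
  rw [← homogeneousComponent_eq_self h, hAB]
  simp only [map_sum, hcomp]
  rw [Finset.sum_eq_single A.totalDegree, Finset.sum_eq_single B.totalDegree]
  · rw [if_pos hdeg]
  · intro j _ hj
    rw [if_neg (by omega)]
  · simp
  · intro i hi hi'
    refine Finset.sum_eq_zero fun j hj => if_neg ?_
    simp only [Finset.mem_range] at hi hj
    omega
  · simp

theorem IsHomogeneous.eval_smul_eq {σ R : Type*} [CommRing R] {n : ℕ} {F : MvPolynomial σ R}
    (h : F.IsHomogeneous n) (t : R) (x : σ → R) : eval (t • x) F = t ^ n * eval x F := by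
  rw [eval_eq, eval_eq, Finset.mul_sum]
  refine Finset.sum_congr rfl fun d hd => ?_
  rw [h.degree_eq_sum_deg_support hd]
  simp only [Pi.smul_apply, smul_eq_mul, mul_pow, Finset.prod_mul_distrib,
    Finset.prod_pow_eq_pow_sum]
  ring

/-- A binary form of positive degree over `ℂ` has a nontrivial zero. -/
theorem IsHomogeneous.exists_eval_eq_zero {n : ℕ} (hn : n ≠ 0) {Φ : MvPolynomial (Fin 2) ℂ}
    (h : Φ.IsHomogeneous n) : ∃ s t : ℂ, (s ≠ 0 ∨ t ≠ 0) ∧ eval ![s, t] Φ = 0 := by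
  have hev : ∀ (v : Fin 2 → Polynomial ℂ) (x : ℂ),
      (MvPolynomial.aeval v Φ).eval x = eval (fun i => (v i).eval x) Φ := by
    intro v x
    have h1 : (Polynomial.aeval x).comp (MvPolynomial.aeval (R := ℂ) v) =
        MvPolynomial.aeval fun i => (v i).eval x := by
      ext i
      simp
    simpa using DFunLike.congr_fun h1 Φ
  by_cases hq : (MvPolynomial.aeval ![Polynomial.X, 1] Φ : Polynomial ℂ).degree = 0
  · -- if `Φ(x, 1)` is a constant `c`, then `Φ(1, y) = c y ^ n`, which vanishes at `y = 0`
    refine ⟨1, 0, by simp, ?_⟩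
    have hconst : ∀ x, eval ![x, 1] Φ = eval ![0, 1] Φ := by
      have h2 : ∀ x, eval ![x, 1] Φ =
          (MvPolynomial.aeval ![Polynomial.X, 1] Φ : Polynomial ℂ).coeff 0 := by
        intro x
        have h1 := hev ![Polynomial.X, 1] x
        rw [Polynomial.eq_C_of_degree_eq_zero hq, Polynomial.eval_C] at h1
        rw [h1]
        congr 2
        ext i
        fin_cases i <;> simp
      intro x
      rw [h2 x, h2 0]
    have hvec : ∀ y, (fun i => (![1, Polynomial.X] i : Polynomial ℂ).eval y) = ![1, y] := by
      intro y
      ext i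
      fin_cases i <;> simp
    have hr : (MvPolynomial.aeval ![1, Polynomial.X] Φ : Polynomial ℂ) =
        Polynomial.C (eval ![0, 1] Φ) * Polynomial.X ^ n := by
      refine mul_left_cancel₀ Polynomial.X_ne_zero (Polynomial.funext fun y => ?_)
      simp only [Polynomial.eval_mul, Polynomial.eval_X, Polynomial.eval_C, Polynomial.eval_pow,
        hev, hvec]
      by_cases hy : y = 0
      · simp [hy]
      · have h3 : ![1, y] = y • ![y⁻¹, 1] := by
          ext i
          fin_cases i <;> simp [hy]
        rw [h3, h.eval_smul_eq, hconst]
        ring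
    have h4 := hev ![1, Polynomial.X] 0
    rw [hr, hvec] at h4
    simpa [hn] using h4.symm
  · obtain ⟨x, hx⟩ := IsAlgClosed.exists_root _ hq
    refine ⟨x, 1, by simp, ?_⟩
    rw [Polynomial.IsRoot, hev] at hx
    rw [← hx]
    congr 2
    ext i
    fin_cases i <;> simp

end MvPolynomial

namespace DelPezzo

/-! ### Double roots of binary quartics -/

/-- The discriminant of the binary quartic `a y⁴ + b y³ z + c y² z² + d y z³ + e z⁴`, multiplied by
`27`. It is `4 I³ - J²`, where `I` and `J` are the invariants of degree two and three. -/
def quarticDiscr {R : Type*} [CommRing R] (a b c d e : R) : R :=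
  4 * (12 * a * e - 3 * b * d + c ^ 2) ^ 3 -
    (72 * a * c * e + 9 * b * c * d - 27 * a * d ^ 2 - 27 * e * b ^ 2 - 2 * c ^ 3) ^ 2

/-- A binary cubic with nonzero leading coefficient and vanishing discriminant has a double
root. -/
theorem exists_double_root_cubic {a b c d : ℂ} (ha : a ≠ 0)
    (h : b ^ 2 * c ^ 2 - 4 * a * c ^ 3 - 4 * b ^ 3 * d - 27 * a ^ 2 * d ^ 2 +
      18 * a * b * c * d = 0) :
    ∃ x : ℂ, a * x ^ 3 + b * x ^ 2 + c * x + d = 0 ∧ 3 * a * x ^ 2 + 2 * b * x + c = 0 := by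
  let P : Cubic ℂ := ⟨a, b, c, d⟩
  obtain ⟨x, y, z, h3⟩ := (Cubic.splits_iff_roots_eq_three (φ := RingHom.id ℂ) (P := P) ha).1
    (IsAlgClosed.splits _)
  have hb : b = a * -(x + y + z) := Cubic.b_eq_three_roots ha h3
  have hc : c = a * (x * y + x * z + y * z) := Cubic.c_eq_three_roots ha h3
  have hd : d = a * -(x * y * z) := Cubic.d_eq_three_roots ha h3
  have hdisc : (a * a * (x - y) * (x - z) * (y - z)) ^ 2 = 0 := by
    rw [← h, hb, hc, hd]
    ring
  have hxyz : x = y ∨ x = z ∨ y = z := by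
    have h1 := pow_eq_zero_iff (two_ne_zero) |>.1 hdisc
    simpa [ha, sub_eq_zero, or_assoc] using h1
  rw [hb, hc, hd]
  rcases hxyz with rfl | rfl | rfl
  · exact ⟨x, by ring, by ring⟩
  · exact ⟨x, by ring, by ring⟩
  · exact ⟨y, by ring, by ring⟩

/-- A binary quartic with vanishing discriminant has a double root in the projective line: a point
where both partial derivatives vanish. -/
theorem exists_double_root_quartic {a b c d e : ℂ} (h : quarticDiscr a b c d e = 0) :
    ∃ y z : ℂ, (y ≠ 0 ∨ z ≠ 0) ∧
      4 * a * y ^ 3 + 3 * b * y ^ 2 * z + 2 * c * y * z ^ 2 + d * z ^ 3 = 0 ∧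
      b * y ^ 3 + 2 * c * y ^ 2 * z + 3 * d * y * z ^ 2 + 4 * e * z ^ 3 = 0 := by
  rw [quarticDiscr] at h
  by_cases ha : a = 0
  · subst ha
    by_cases hb : b = 0
    · exact ⟨1, 0, by simp, by simp, by simp [hb]⟩
    have hdisc : c ^ 2 * d ^ 2 - 4 * b * d ^ 3 - 4 * c ^ 3 * e - 27 * b ^ 2 * e ^ 2 +
        18 * b * c * d * e = 0 := by
      refine (mul_eq_zero.1 (?_ : (27 * b ^ 2) * _ = 0)).resolve_left (by simp [hb])
      rw [← h]
      ring
    obtain ⟨x, h1, h2⟩ := exists_double_root_cubic hb hdisc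
    exact ⟨x, 1, by simp, by linear_combination h2, by linear_combination 4 * h1 - x * h2⟩
  -- split off a linear factor `y - r z`
  obtain ⟨r, hr⟩ : ∃ r : ℂ, a * r ^ 4 + b * r ^ 3 + c * r ^ 2 + d * r + e = 0 := by
    let q : Polynomial ℂ := .C a * .X ^ 4 + .C b * .X ^ 3 + .C c * .X ^ 2 + .C d * .X + .C e
    have hq : q.degree = 4 := by
      unfold q
      compute_degree!
    obtain ⟨r, hr⟩ := IsAlgClosed.exists_root q (by rw [hq]; decide)
    exact ⟨r, by simpa [q] using hr⟩
  obtain ⟨β, rfl⟩ : ∃ β, b = β - a * r := ⟨b + a * r, by ring⟩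
  obtain ⟨γ, rfl⟩ : ∃ γ, c = γ - r * β := ⟨c + r * β, by ring⟩
  obtain ⟨δ, rfl⟩ : ∃ δ, d = δ - r * γ := ⟨d + r * γ, by ring⟩
  obtain rfl : e = -(r * δ) := by linear_combination hr
  have hfac : (a * r ^ 3 + β * r ^ 2 + γ * r + δ) ^ 2 * (β ^ 2 * γ ^ 2 - 4 * a * γ ^ 3 -
      4 * β ^ 3 * δ - 27 * a ^ 2 * δ ^ 2 + 18 * a * β * γ * δ) = 0 := by
    refine (mul_eq_zero.1 (?_ : (27 : ℂ) * _ = 0)).resolve_left (by norm_num)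
    rw [← h]
    ring
  rcases mul_eq_zero.1 hfac with h1 | h1
  · have h2 := pow_eq_zero_iff (two_ne_zero) |>.1 h1
    exact ⟨r, 1, by simp, by linear_combination h2, by linear_combination -r * h2⟩
  · obtain ⟨x, h2, h3⟩ := exists_double_root_cubic ha h1
    exact ⟨x, 1, by simp, by linear_combination h2 + (x - r) * h3,
      by linear_combination (3 * x - 4 * r) * h2 - x * (x - r) * h3⟩

open MvPolynomial

/-! ### Ternary cubic forms -/

/-- The exponents of the ten monomials of degree three in three variables. -/
noncomputable def cubicExponent (k : Fin 10) : Fin 3 →₀ ℕ :=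
  Finsupp.equivFunOnFinite.symm
    (![![3, 0, 0], ![2, 1, 0], ![2, 0, 1], ![1, 2, 0], ![1, 1, 1], ![1, 0, 2], ![0, 3, 0],
      ![0, 2, 1], ![0, 1, 2], ![0, 0, 3]] k)

theorem cubicExponent_injective : Function.Injective cubicExponent :=
  Finsupp.equivFunOnFinite.symm.injective.comp (by decide)

theorem degree_cubicExponent (k : Fin 10) : (cubicExponent k).degree = 3 := by
  rw [Finsupp.degree_eq_sum]
  fin_cases k <;> rfl

theorem exists_cubicExponent_eq {d : Fin 3 →₀ ℕ} (hd : d.degree = 3) :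
    ∃ k, cubicExponent k = d := by
  rw [Finsupp.degree_eq_sum, Fin.sum_univ_three] at hd
  have h : ∀ k, d 0 = cubicExponent k 0 → d 1 = cubicExponent k 1 →
      d 2 = cubicExponent k 2 → ∃ k, cubicExponent k = d := fun k h0 h1 h2 =>
    ⟨k, by ext i; fin_cases i; exacts [h0.symm, h1.symm, h2.symm]⟩
  obtain ⟨x, hx⟩ : ∃ x, x = d 0 := ⟨_, rfl⟩
  obtain ⟨y, hy⟩ : ∃ y, y = d 1 := ⟨_, rfl⟩
  have hz : d 2 = 3 - x - y := by omega
  have hx3 : x ≤ 3 := by omega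
  have hy3 : y ≤ 3 - x := by omega
  rw [hz, ← hx, ← hy] at h
  interval_cases x <;> interval_cases y
  exacts [h 9 rfl rfl rfl, h 8 rfl rfl rfl, h 7 rfl rfl rfl, h 6 rfl rfl rfl, h 5 rfl rfl rfl,
    h 4 rfl rfl rfl, h 3 rfl rfl rfl, h 2 rfl rfl rfl, h 1 rfl rfl rfl, h 0 rfl rfl rfl]

/-- The ternary cubic form with given coefficients, in the order of `cubicExponent`. -/
noncomputable def cubicForm : (Fin 10 → ℂ) →ₗ[ℂ] Form :=
  ∑ k, MvPolynomial.monomial (cubicExponent k) ∘ₗ LinearMap.proj k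

theorem cubicForm_apply (c : Fin 10 → ℂ) :
    cubicForm c = ∑ k, MvPolynomial.monomial (cubicExponent k) (c k) := by
  simp [cubicForm]

theorem cubicForm_isHomogeneous (c : Fin 10 → ℂ) : (cubicForm c).IsHomogeneous 3 := by
  rw [cubicForm_apply]
  exact IsHomogeneous.sum _ _ _ fun k _ => isHomogeneous_monomial _ (degree_cubicExponent k)

theorem coeff_cubicForm (c : Fin 10 → ℂ) (k : Fin 10) :
    (cubicForm c).coeff (cubicExponent k) = c k := by
  rw [cubicForm_apply, coeff_sum, Finset.sum_eq_single k]
  · simp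
  · intro j _ hj
    rw [coeff_monomial, if_neg (cubicExponent_injective.ne hj)]
  · simp

theorem cubicForm_injective : Function.Injective cubicForm := fun c c' h => by
  ext k
  rw [← coeff_cubicForm c k, h, coeff_cubicForm]

theorem exists_cubicForm_eq {F : Form} (hF : F.IsHomogeneous 3) : ∃ c, cubicForm c = F := by
  refine ⟨fun k => F.coeff (cubicExponent k), ?_⟩
  ext d
  by_cases hd : d.degree = 3
  · obtain ⟨k, rfl⟩ := exists_cubicExponent_eq hd
    rw [coeff_cubicForm]
  · rw [hF.coeff_eq_zero hd, (cubicForm_isHomogeneous _).coeff_eq_zero hd]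

theorem cubicForm_eq (c : Fin 10 → ℂ) : cubicForm c =
    C (c 0) * X 0 ^ 3 + C (c 1) * (X 0 ^ 2 * X 1) + C (c 2) * (X 0 ^ 2 * X 2) +
      C (c 3) * (X 0 * X 1 ^ 2) + C (c 4) * (X 0 * X 1 * X 2) + C (c 5) * (X 0 * X 2 ^ 2) +
      C (c 6) * X 1 ^ 3 + C (c 7) * (X 1 ^ 2 * X 2) + C (c 8) * (X 1 * X 2 ^ 2) +
      C (c 9) * X 2 ^ 3 := by
  simp only [cubicForm_apply, Fin.sum_univ_succ, monomial_eq, Finsupp.prod_fintype,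
    Fin.prod_univ_three, cubicExponent, Finsupp.coe_equivFunOnFinite_symm, pow_zero, implies_true]
  simp
  ring

theorem eval_cubicForm (c : Fin 10 → ℂ) (x : Vec) : eval x (cubicForm c) =
    c 0 * x 0 ^ 3 + c 1 * (x 0 ^ 2 * x 1) + c 2 * (x 0 ^ 2 * x 2) +
      c 3 * (x 0 * x 1 ^ 2) + c 4 * (x 0 * x 1 * x 2) + c 5 * (x 0 * x 2 ^ 2) +
      c 6 * x 1 ^ 3 + c 7 * (x 1 ^ 2 * x 2) + c 8 * (x 1 * x 2 ^ 2) + c 9 * x 2 ^ 3 := by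
  simp [cubicForm_eq]

theorem eval_pderiv_zero_cubicForm (c : Fin 10 → ℂ) (x : Vec) :
    eval x (pderiv 0 (cubicForm c)) =
      3 * c 0 * x 0 ^ 2 + 2 * c 1 * (x 0 * x 1) + 2 * c 2 * (x 0 * x 2) +
      c 3 * x 1 ^ 2 + c 4 * (x 1 * x 2) + c 5 * x 2 ^ 2 := by
  simp [cubicForm_eq, pderiv_X, Derivation.leibniz_pow]
  ring

theorem eval_pderiv_one_cubicForm (c : Fin 10 → ℂ) (x : Vec) :
    eval x (pderiv 1 (cubicForm c)) =
      c 1 * x 0 ^ 2 + 2 * c 3 * (x 0 * x 1) + c 4 * (x 0 * x 2) +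
      3 * c 6 * x 1 ^ 2 + 2 * c 7 * (x 1 * x 2) + c 8 * x 2 ^ 2 := by
  simp [cubicForm_eq, pderiv_X, Derivation.leibniz_pow]
  ring

theorem eval_pderiv_two_cubicForm (c : Fin 10 → ℂ) (x : Vec) :
    eval x (pderiv 2 (cubicForm c)) =
      c 2 * x 0 ^ 2 + c 4 * (x 0 * x 1) + 2 * c 5 * (x 0 * x 2) +
      c 7 * x 1 ^ 2 + 2 * c 8 * (x 1 * x 2) + 3 * c 9 * x 2 ^ 2 := by
  simp [cubicForm_eq, pderiv_X, Derivation.leibniz_pow]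
  ring

/-- A cubic that is singular at two points contains the line joining them. -/
theorem eval_eq_zero_of_singular {F : Form} (hF : F.IsHomogeneous 3) {x y : Vec}
    (hx : ∀ j, eval x (pderiv j F) = 0) (hy : ∀ j, eval y (pderiv j F) = 0) (s t : ℂ) :
    eval (s • x + t • y) F = 0 := by
  obtain ⟨c, rfl⟩ := exists_cubicForm_eq hF
  have hx0 := hx 0
  have hx1 := hx 1
  have hx2 := hx 2
  have hy0 := hy 0
  have hy1 := hy 1
  have hy2 := hy 2
  rw [eval_pderiv_zero_cubicForm] at hx0 hy0
  rw [eval_pderiv_one_cubicForm] at hx1 hy1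
  rw [eval_pderiv_two_cubicForm] at hx2 hy2
  rw [eval_cubicForm]
  simp only [Pi.add_apply, Pi.smul_apply, smul_eq_mul]
  linear_combination (s ^ 3 * x 0 / 3 + s ^ 2 * t * y 0) * hx0 +
    (s ^ 3 * x 1 / 3 + s ^ 2 * t * y 1) * hx1 + (s ^ 3 * x 2 / 3 + s ^ 2 * t * y 2) * hx2 +
    (t ^ 3 * y 0 / 3 + s * t ^ 2 * x 0) * hy0 + (t ^ 3 * y 1 / 3 + s * t ^ 2 * x 1) * hy1 +
    (t ^ 3 * y 2 / 3 + s * t ^ 2 * x 2) * hy2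

/-- A cubic containing a line, given as the zero set of a linear form, is reducible: by the
Nullstellensatz the linear form, which is prime, divides the cubic. -/
theorem not_irreducible_of_forall_eval_eq_zero {F : Form} (hF : F.IsHomogeneous 3) {w : Vec}
    (hw : w ≠ 0) (h : ∀ v, w ⬝ᵥ v = 0 → eval v F = 0) : ¬ Irreducible F := by
  intro hirr
  let ℓ : Form := ∑ j, C (w j) * X j
  have hev : ∀ v, eval v ℓ = w ⬝ᵥ v := fun v => by simp [ℓ, dotProduct]
  have hℓ0 : ℓ ≠ 0 := by
    intro h0
    refine hw (dotProduct_eq_zero w fun v => ?_)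
    rw [← hev, h0, map_zero]
  have hℓ1 : ℓ.IsHomogeneous 1 := IsHomogeneous.sum _ _ _ fun j _ => isHomogeneous_C_mul_X _ _
  have hdeg : ℓ.totalDegree = 1 := hℓ1.totalDegree hℓ0
  have hrad : F ∈ (Ideal.span {ℓ}).radical := by
    rw [← vanishingIdeal_zeroLocus_eq_radical (K := ℂ)]
    rw [mem_vanishingIdeal_iff]
    intro v hv
    have h1 := mem_zeroLocus_iff.1 hv ℓ (Ideal.mem_span_singleton_self ℓ)
    simp only [aeval_eq_eval] at h1 ⊢
    exact h v (by rw [← hev]; exact h1)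
  obtain ⟨n, hn⟩ := hrad
  have hirrℓ : Irreducible ℓ := by
    refine irreducible_of_totalDegree_eq_one hdeg fun x hx => ?_
    refine isUnit_iff_ne_zero.2 ?_
    rintro rfl
    exact hℓ0 (by ext d; simpa using hx d)
  have hdvd : ℓ ∣ F := hirrℓ.prime.dvd_of_dvd_pow (Ideal.mem_span_singleton.1 hn)
  have hass := (hirrℓ.associated_of_dvd hirr hdvd)
  obtain ⟨u, hu⟩ := hass
  have h3 := hF.totalDegree hirr.ne_zero
  rw [← hu, totalDegree_mul_of_isDomain hℓ0 u.ne_zero, hdeg,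
    (isUnit_iff_totalDegree_of_isReduced.1 u.isUnit).2] at h3
  omega

/-! ### Lines in the plane -/

theorem exists_ne_zero_dotProduct_eq_zero (x y : Vec) :
    ∃ w : Vec, w ≠ 0 ∧ x ⬝ᵥ w = 0 ∧ y ⬝ᵥ w = 0 := by
  let T : Vec →ₗ[ℂ] (ℂ × ℂ) := (dotProductBilin ℂ ℂ x).prod (dotProductBilin ℂ ℂ y)
  have hT : ¬ Function.Injective T := fun h => by
    have := LinearMap.finrank_le_finrank_of_injective h
    simp at this
  rw [← LinearMap.ker_eq_bot, Submodule.eq_bot_iff] at hT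
  push Not at hT
  obtain ⟨w, hw, hw0⟩ := hT
  have h : (x ⬝ᵥ w, y ⬝ᵥ w) = 0 := hw
  exact ⟨w, hw0, congrArg Prod.fst h, congrArg Prod.snd h⟩

theorem eq_zero_of_forall_dotProduct_eq_zero {v : Fin 3 → Vec} (hv : LinearIndependent ℂ v)
    {w : Vec} (hw : ∀ i, v i ⬝ᵥ w = 0) : w = 0 := by
  have hu : IsUnit (Matrix.of v) := Matrix.linearIndependent_rows_iff_isUnit.1 hv
  refine Matrix.mulVec_injective_of_isUnit hu ?_
  rw [Matrix.mulVec_zero]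
  ext i
  exact hw i

/-- The line through two distinct points is the zero set of a linear form. -/
theorem exists_line_eq_span {x y : Vec} (h : LinearIndependent ℂ ![x, y]) :
    ∃ w : Vec, w ≠ 0 ∧ ∀ v, w ⬝ᵥ v = 0 → ∃ s t : ℂ, s • x + t • y = v := by
  obtain ⟨w, hw, hx, hy⟩ := exists_ne_zero_dotProduct_eq_zero x y
  refine ⟨w, hw, fun v hv => ?_⟩
  rw [← Submodule.mem_span_pair]
  by_contra hmem
  rw [← Matrix.range_cons_cons_empty x y ![]] at hmem
  refine hw (eq_zero_of_forall_dotProduct_eq_zero (linearIndependent_finSnoc.2 ⟨h, hmem⟩) ?_)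
  intro i
  fin_cases i
  exacts [hx, hy, (dotProduct_comm _ _).trans hv]

theorem not_irreducible_of_eval_line_eq_zero {F : Form} (hF : F.IsHomogeneous 3) {x y : Vec}
    (h : LinearIndependent ℂ ![x, y]) (h0 : ∀ s t : ℂ, eval (s • x + t • y) F = 0) :
    ¬ Irreducible F := by
  obtain ⟨w, hw, hline⟩ := exists_line_eq_span h
  refine not_irreducible_of_forall_eval_eq_zero hF hw fun v hv => ?_
  obtain ⟨s, t, rfl⟩ := hline v hv
  exact h0 s t

/-! ### Singular points of plane curves -/

theorem vanishesAt_mk {n : ℕ} {F : Form} (hF : F.IsHomogeneous n) {v : Vec} (hv : v ≠ 0) :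
    VanishesAt F (Projectivization.mk ℂ v hv) ↔ eval v F = 0 := by
  obtain ⟨a, ha⟩ := Projectivization.exists_smul_eq_mk_rep ℂ v hv
  rw [VanishesAt, ← ha, Units.smul_def, hF.eval_smul_eq]
  simp

/-- By Euler's identity, a curve passes through the points where its partial derivatives
vanish. -/
theorem isSingularAt_mk {n : ℕ} {F : Form} (hF : F.IsHomogeneous n) (hn : n ≠ 0) {v : Vec}
    (hv : v ≠ 0) :
    IsSingularAt F (Projectivization.mk ℂ v hv) ↔ ∀ j, eval v (pderiv j F) = 0 := by
  rw [IsSingularAt, vanishesAt_mk hF]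
  simp only [fun j => vanishesAt_mk (hF.pderiv (i := j)) hv]
  refine ⟨fun h => h.2, fun h => ⟨?_, h⟩⟩
  have h1 := congrArg (eval v) hF.sum_X_mul_pderiv
  simpa [h, hn] using h1

/-- An irreducible cubic has at most one singular point. -/
theorem eq_of_isSingularAt {F : Form} (hF : F.IsHomogeneous 3) (hirr : Irreducible F)
    {x y : Plane} (hx : IsSingularAt F x) (hy : IsSingularAt F y) : x = y := by
  by_contra hxy
  have hli : LinearIndependent ℂ ![x.rep, y.rep] := by
    have h1 := Projectivization.independent_iff.1
      ((Projectivization.independent_pair_iff_ne x y).2 hxy)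
    have h2 : ![x.rep, y.rep] = Projectivization.rep ∘ ![x, y] := by
      ext i : 1
      fin_cases i <;> rfl
    rw [h2]
    exact h1
  exact not_irreducible_of_eval_line_eq_zero hF hli
    (eval_eq_zero_of_singular hF hx.2 hy.2) hirr

/-! ### Cubics through eight points in general position -/

theorem totalDegree_pos_of_not_isUnit {A : Form} (h0 : A ≠ 0) (h : ¬ IsUnit A) :
    0 < A.totalDegree := by
  rw [Nat.pos_iff_ne_zero]
  intro hA
  rw [totalDegree_eq_zero_iff_eq_C] at hA
  refine h ?_
  rw [hA] at h0 ⊢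
  exact (isUnit_iff_ne_zero.2 fun h1 => h0 (by rw [h1, map_zero])).map C

namespace GeneralPosition

variable {P : Fin 8 → Plane}

/-- A line contains at most two, a conic at most five of the eight points, so that a line and a
conic do not cover them. -/
theorem mul_not_vanishesAt (hP : GeneralPosition P) {A B : Form} (hA : A.IsHomogeneous 1)
    (hB : B.IsHomogeneous 2) (hA0 : A ≠ 0) (hB0 : B ≠ 0)
    (h : ∀ i, VanishesAt (A * B) (P i)) : False := by
  classical
  have hcover : ∀ i, VanishesAt A (P i) ∨ VanishesAt B (P i) := fun i => by
    simpa [VanishesAt] using h i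
  have h1 : (Finset.univ.filter fun i => VanishesAt A (P i)).card ≤ 2 := by
    by_contra! hc
    obtain ⟨s, hs, hcard⟩ := Finset.exists_subset_card_eq (n := 3) hc
    exact hP.no_three_on_line s hcard ⟨A, hA0, hA, fun i hi => (Finset.mem_filter.1 (hs hi)).2⟩
  have h2 : (Finset.univ.filter fun i => VanishesAt B (P i)).card ≤ 5 := by
    by_contra! hc
    obtain ⟨s, hs, hcard⟩ := Finset.exists_subset_card_eq (n := 6) hc
    exact hP.no_six_on_conic s hcard ⟨B, hB0, hB, fun i hi => (Finset.mem_filter.1 (hs hi)).2⟩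
  have h3 := Finset.card_union_le (Finset.univ.filter fun i => VanishesAt A (P i))
    (Finset.univ.filter fun i => VanishesAt B (P i))
  have h4 : (Finset.univ.filter fun i => VanishesAt A (P i)) ∪
      (Finset.univ.filter fun i => VanishesAt B (P i)) = Finset.univ := by
    ext i
    simpa using hcover i
  rw [h4, Finset.card_univ, Fintype.card_fin] at h3
  omega

theorem irreducible (hP : GeneralPosition P) {F : Form} (hF : F.IsHomogeneous 3) (hF0 : F ≠ 0)
    (h : ∀ i, VanishesAt F (P i)) : Irreducible F where
  not_isUnit hu := by
    have h1 := (isUnit_iff_totalDegree_of_isReduced.1 hu).2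
    rw [hF.totalDegree hF0] at h1
    omega
  isUnit_or_isUnit A B hAB := by
    subst hAB
    by_contra! hc
    obtain ⟨hdeg, hmul⟩ := hF.eq_mul_homogeneousComponent hF0
    have hA := totalDegree_pos_of_not_isUnit (left_ne_zero_of_mul hF0) hc.1
    have hB := totalDegree_pos_of_not_isUnit (right_ne_zero_of_mul hF0) hc.2
    have hA1 := homogeneousComponent_isHomogeneous A.totalDegree A
    have hB1 := homogeneousComponent_isHomogeneous B.totalDegree B
    rw [hmul] at h hF0
    obtain h1 | h1 : A.totalDegree = 1 ∧ B.totalDegree = 2 ∨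
        A.totalDegree = 2 ∧ B.totalDegree = 1 := by omega
    · rw [h1.1, h1.2] at h hF0
      rw [h1.1] at hA1
      rw [h1.2] at hB1
      exact hP.mul_not_vanishesAt hA1 hB1 (left_ne_zero_of_mul hF0) (right_ne_zero_of_mul hF0) h
    · rw [h1.1, h1.2, mul_comm] at h hF0
      rw [h1.1] at hA1
      rw [h1.2] at hB1
      exact hP.mul_not_vanishesAt hB1 hA1 (left_ne_zero_of_mul hF0) (right_ne_zero_of_mul hF0) h

end GeneralPosition

/-- Eight points lie on the members of a pencil of cubics. -/
theorem exists_pencil (P : Fin 8 → Plane) : ∃ c c' : Fin 10 → ℂ, LinearIndependent ℂ ![c, c'] ∧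
    (∀ i, VanishesAt (cubicForm c) (P i)) ∧ ∀ i, VanishesAt (cubicForm c') (P i) := by
  let T : (Fin 10 → ℂ) →ₗ[ℂ] (Fin 8 → ℂ) :=
    LinearMap.pi fun i => (aeval (P i).rep).toLinearMap ∘ₗ cubicForm
  have hT : ∀ c ∈ LinearMap.ker T, ∀ i, VanishesAt (cubicForm c) (P i) := fun c hc i => by
    simpa [VanishesAt, T] using congrFun (LinearMap.mem_ker.1 hc) i
  have hker : 1 < Module.finrank ℂ (LinearMap.ker T) := by
    have h1 := T.finrank_range_add_finrank_ker
    have h2 := Submodule.finrank_le (LinearMap.range T)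
    simp only [Module.finrank_fintype_fun_eq_card, Fintype.card_fin] at h1 h2
    omega
  have : Nontrivial (LinearMap.ker T) := Module.nontrivial_of_finrank_pos (R := ℂ) (by omega)
  obtain ⟨c, hc⟩ := exists_ne (0 : LinearMap.ker T)
  obtain ⟨c', hc'⟩ := exists_linearIndependent_pair_of_one_lt_finrank hker hc
  refine ⟨c, c', ?_, hT _ c.2, hT _ c'.2⟩
  have h1 : ![c.1, c'.1] = (LinearMap.ker T).subtype ∘ ![c, c'] := by
    ext i : 1
    fin_cases i <;> rfl
  rw [h1]
  exact hc'.map' (LinearMap.ker T).subtype (Submodule.ker_subtype _)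

/-! ### The discriminant of the tangent lines from a point of a cubic -/

/-- For a cubic `x² L + x Q + K` through `(1 : 0 : 0)`, with `L`, `Q`, `K` binary forms in `y, z`,
`27` times the discriminant of the quartic `Q² - 4 L K`, whose zeros are the directions of the
tangent lines of the cubic that pass through `(1 : 0 : 0)`. The coefficients of the cubic are
ordered as in `cubicExponent`. -/
def tangentDiscr {R : Type*} [CommRing R] (c : Fin 10 → R) : R :=
  quarticDiscr (c 3 ^ 2 - 4 * c 1 * c 6) (2 * c 3 * c 4 - 4 * (c 1 * c 7 + c 2 * c 6))
    (c 4 ^ 2 + 2 * c 3 * c 5 - 4 * (c 1 * c 8 + c 2 * c 7))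
    (2 * c 4 * c 5 - 4 * (c 1 * c 9 + c 2 * c 8)) (c 5 ^ 2 - 4 * c 2 * c 9)

theorem map_tangentDiscr {R S : Type*} [CommRing R] [CommRing S] (φ : R →+* S) (c : Fin 10 → R) :
    φ (tangentDiscr c) = tangentDiscr fun k => φ (c k) := by
  simp [tangentDiscr, quarticDiscr, map_ofNat]

theorem isHomogeneous_ofNat_mul {σ : Type*} {m : ℕ} {p : MvPolynomial σ ℂ} (k : ℕ)
    [k.AtLeastTwo] (hp : p.IsHomogeneous m) :
    ((OfNat.ofNat k : MvPolynomial σ ℂ) * p).IsHomogeneous m := by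
  have := hp.C_mul (OfNat.ofNat k : ℂ)
  rwa [map_ofNat] at this

theorem quarticDiscr_isHomogeneous {σ : Type*} {n : ℕ} {a b c d e : MvPolynomial σ ℂ}
    (ha : a.IsHomogeneous n) (hb : b.IsHomogeneous n) (hc : c.IsHomogeneous n)
    (hd : d.IsHomogeneous n) (he : e.IsHomogeneous n) :
    (quarticDiscr a b c d e).IsHomogeneous (6 * n) := by
  have hI : (12 * a * e - 3 * b * d + c ^ 2).IsHomogeneous (n * 2) := by
    have h1 : (12 * (a * e) - 3 * (b * d) + c ^ 2).IsHomogeneous (n * 2) := by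
      refine ((isHomogeneous_ofNat_mul 12 ?_).sub (isHomogeneous_ofNat_mul 3 ?_)).add (hc.pow 2)
      · simpa [mul_two] using ha.mul he
      · simpa [mul_two] using hb.mul hd
    simpa only [mul_assoc] using h1
  have h3 : ∀ {p q r : MvPolynomial σ ℂ}, p.IsHomogeneous n → q.IsHomogeneous n →
      r.IsHomogeneous n → (p * q * r).IsHomogeneous (n * 3) := by
    intro p q r hp hq hr
    have := (hp.mul hq).mul hr
    rwa [show n + n + n = n * 3 by ring] at this
  have hJ : (72 * a * c * e + 9 * b * c * d - 27 * a * d ^ 2 - 27 * e * b ^ 2 -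
      2 * c ^ 3).IsHomogeneous (n * 3) := by
    have h1 := ((((isHomogeneous_ofNat_mul 72 (h3 ha hc he)).add
      (isHomogeneous_ofNat_mul 9 (h3 hb hc hd))).sub
      (isHomogeneous_ofNat_mul 27 (h3 ha hd hd))).sub
      (isHomogeneous_ofNat_mul 27 (h3 he hb hb))).sub (isHomogeneous_ofNat_mul 2 (hc.pow 3))
    simpa only [mul_assoc, pow_two] using h1
  have h1 := (isHomogeneous_ofNat_mul 4 (hI.pow 3)).sub (by
    have := hJ.pow 2
    rwa [show n * 3 * 2 = n * 2 * 3 by ring] at this)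
  rw [show n * 2 * 3 = 6 * n by ring] at h1
  exact h1

theorem tangentDiscr_isHomogeneous {σ : Type*} {c : Fin 10 → MvPolynomial σ ℂ}
    (hc : ∀ k, (c k).IsHomogeneous 1) : (tangentDiscr c).IsHomogeneous 12 := by
  have h2 : ∀ i j, (c i * c j).IsHomogeneous 2 := fun i j => (hc i).mul (hc j)
  have h3 : ∀ i, (c i ^ 2).IsHomogeneous 2 := fun i => (hc i).pow 2
  refine quarticDiscr_isHomogeneous (n := 2) ?_ ?_ ?_ ?_ ?_ <;> simp only [mul_assoc]
  · exact (h3 3).sub (isHomogeneous_ofNat_mul 4 (h2 1 6))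
  · exact (isHomogeneous_ofNat_mul 2 (h2 3 4)).sub
      (isHomogeneous_ofNat_mul 4 ((h2 1 7).add (h2 2 6)))
  · exact ((h3 4).add (isHomogeneous_ofNat_mul 2 (h2 3 5))).sub
      (isHomogeneous_ofNat_mul 4 ((h2 1 8).add (h2 2 7)))
  · exact (isHomogeneous_ofNat_mul 2 (h2 4 5)).sub
      (isHomogeneous_ofNat_mul 4 ((h2 1 9).add (h2 2 8)))
  · exact (h3 5).sub (isHomogeneous_ofNat_mul 4 (h2 2 9))

/-- The discriminant is a binary form of degree twelve in the parameters of the pencil. -/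
theorem exists_tangentDiscr_eq_zero (c c' : Fin 10 → ℂ) :
    ∃ s t : ℂ, (s ≠ 0 ∨ t ≠ 0) ∧ tangentDiscr (s • c + t • c') = 0 := by
  have hhom : (tangentDiscr fun k => (C (c k) * X 0 + C (c' k) * X 1 :
      MvPolynomial (Fin 2) ℂ)).IsHomogeneous 12 :=
    tangentDiscr_isHomogeneous fun k =>
      (isHomogeneous_C_mul_X _ _).add (isHomogeneous_C_mul_X _ _)
  obtain ⟨s, t, hst, h⟩ := hhom.exists_eval_eq_zero (by norm_num)
  refine ⟨s, t, hst, ?_⟩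
  rw [map_tangentDiscr] at h
  rw [← h]
  congr 1
  ext k
  simp [mul_comm]

/-- A cubic through `(1 : 0 : 0)` two of whose tangent lines from there coincide is singular or
contains a line through `(1 : 0 : 0)`. -/
theorem exists_singular_or_line {c : Fin 10 → ℂ} (h0 : c 0 = 0) (hc : tangentDiscr c = 0) :
    (∃ v : Vec, v ≠ 0 ∧ ∀ j, eval v (pderiv j (cubicForm c)) = 0) ∨
      ∃ y z : ℂ, (y ≠ 0 ∨ z ≠ 0) ∧ ∀ s t, eval ![s, t * y, t * z] (cubicForm c) = 0 := by
  obtain ⟨y, z, hyz, hDy, hDz⟩ := exists_double_root_quartic hc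
  set L := c 1 * y + c 2 * z with hL
  set Q := c 3 * y ^ 2 + c 4 * y * z + c 5 * z ^ 2 with hQ
  set K := c 6 * y ^ 3 + c 7 * y ^ 2 * z + c 8 * y * z ^ 2 + c 9 * z ^ 3 with hK
  have hD : Q ^ 2 - 4 * L * K = 0 := by
    linear_combination (y / 4) * hDy + (z / 4) * hDz
  by_cases hL0 : L = 0
  · have hQ0 : Q = 0 := by
      rw [hL0] at hD
      simpa using hD
    by_cases hK0 : K = 0
    · refine Or.inr ⟨y, z, hyz, fun s t => ?_⟩
      rw [eval_cubicForm]
      simp only [Matrix.cons_val_zero, Matrix.cons_val_one, Matrix.cons_val, h0]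
      linear_combination s ^ 2 * t * hL0 + s * t ^ 2 * hQ0 + t ^ 3 * hK0
    · -- the derivatives of `Q² - 4 L K` at `(y, z)` are `-4 K` times those of `L`, so that `L`
      -- vanishes identically and `(1 : 0 : 0)` is singular
      have h1 : c 1 = 0 := by
        refine (mul_eq_zero.1 (?_ : (4 * K) * c 1 = 0)).resolve_left (by simpa using hK0)
        linear_combination 2 * (2 * c 3 * y + c 4 * z) * hQ0 -
          4 * (3 * c 6 * y ^ 2 + 2 * c 7 * y * z + c 8 * z ^ 2) * hL0 - hDy
      have h2 : c 2 = 0 := by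
        refine (mul_eq_zero.1 (?_ : (4 * K) * c 2 = 0)).resolve_left (by simpa using hK0)
        linear_combination 2 * (c 4 * y + 2 * c 5 * z) * hQ0 -
          4 * (c 7 * y ^ 2 + 2 * c 8 * y * z + 3 * c 9 * z ^ 2) * hL0 - hDz
      refine Or.inl ⟨![1, 0, 0], fun h => by simpa using congrFun h 0, fun j => ?_⟩
      fin_cases j
      · simp [eval_pderiv_zero_cubicForm, h0]
      · simp [eval_pderiv_one_cubicForm, h1]
      · simp [eval_pderiv_two_cubicForm, h2]
  · -- the line in the direction `(y : z)` touches the cubic at the double root `x = -Q / 2 L`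
    -- of `x² L + x Q + K`
    left
    have hv : ∀ x : ℂ, x = -Q / (2 * L) → ∀ j, eval ![x, y, z] (pderiv j (cubicForm c)) = 0 := by
      intro x hx
      have hx1 : 2 * L * x + Q = 0 := by
        rw [hx]
        field_simp
        ring
      have hf : x ^ 2 * L + x * Q + K = 0 := by
        refine (mul_eq_zero.1 (?_ : (4 * L) * _ = 0)).resolve_left (by simpa using hL0)
        linear_combination (2 * L * x + Q) * hx1 - hD
      -- differentiate the identity `4 L (x² L + x Q + K) = (2 L x + Q)² - (Q² - 4 L K)`
      intro j
      fin_cases j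
      · simp only [Fin.zero_eta, eval_pderiv_zero_cubicForm, Matrix.cons_val_zero,
          Matrix.cons_val_one, Matrix.cons_val, h0]
        linear_combination hx1
      · refine (mul_eq_zero.1 (?_ : (4 * L) * _ = 0)).resolve_left (by simpa using hL0)
        simp only [Fin.mk_one, eval_pderiv_one_cubicForm, Matrix.cons_val_zero,
          Matrix.cons_val_one, Matrix.cons_val]
        linear_combination 2 * (2 * c 1 * x + (2 * c 3 * y + c 4 * z)) * hx1 - hDy -
          4 * c 1 * hf
      · refine (mul_eq_zero.1 (?_ : (4 * L) * _ = 0)).resolve_left (by simpa using hL0)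
        simp only [Fin.reduceFinMk, eval_pderiv_two_cubicForm, Matrix.cons_val_zero,
          Matrix.cons_val_one, Matrix.cons_val]
        linear_combination 2 * (2 * c 2 * x + (c 4 * y + 2 * c 5 * z)) * hx1 - hDz -
          4 * c 2 * hf
    refine ⟨_, ?_, hv _ rfl⟩
    intro h
    rcases hyz with hy | hz
    · exact hy (by simpa using congrFun h 1)
    · exact hz (by simpa using congrFun h 2)

/-! ### Points and frames of the blow-up -/

namespace BlowUp

/-- The blow-down is surjective. -/
theorem exists_f_eq {r : ℕ} (P : Fin r → Plane) (x : Plane) : ∃ Q : BlowUp P, Q.f = x := by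
  choose w hw0 hPw hxw using fun i => exists_ne_zero_dotProduct_eq_zero (P i).rep x.rep
  refine ⟨⟨x, fun i => Projectivization.mk ℂ (w i) (hw0 i), fun i => ?_, fun i => ?_⟩, rfl⟩
  · rw [← (P i).mk_rep]
    exact hPw i
  · rw [← x.mk_rep]
    exact hxw i

/-- The blow-down is injective off the exceptional curves, since the line through two distinct
points is unique. -/
theorem eq_of_f_eq {r : ℕ} {P : Fin r → Plane} {Q Q' : BlowUp P} (h : Q.f = Q'.f)
    (hQ : ¬ Q.IsExceptional) : Q = Q' := by
  refine BlowUp.ext h (funext fun i => ?_)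
  have h1 := Q'.f_mem_line i
  rw [← h] at h1
  exact (Configuration.ofField.eq_or_eq_of_orthogonal (Q.f_mem_line i) (Q.center_mem_line i) h1
    (Q'.center_mem_line i)).resolve_left fun h2 => hQ ⟨i, h2⟩

namespace Frame

variable {r : ℕ} {P : Fin r → Plane} {Q : BlowUp P} (κ : Frame Q)

theorem p_ne_zero : κ.p ≠ 0 := κ.linearIndependent.ne_zero 0

theorem vanishesAt_iff {n : ℕ} {F : Form} (hF : F.IsHomogeneous n) :
    VanishesAt F Q.f ↔ eval κ.p F = 0 := by
  rw [← vanishesAt_mk hF κ.p_ne_zero]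
  exact iff_of_eq (congrArg _ κ.mk_p.symm)

theorem isSingularAt_iff {n : ℕ} {F : Form} (hF : F.IsHomogeneous n) (hn : n ≠ 0) :
    IsSingularAt F Q.f ↔ ∀ j, eval κ.p (pderiv j F) = 0 := by
  rw [← isSingularAt_mk hF hn κ.p_ne_zero]
  exact iff_of_eq (congrArg _ κ.mk_p.symm)

end Frame

end BlowUp

/-! ### A singular cubic through eight points -/

/-- The form `F` in the coordinates given by the basis `v`. -/
noncomputable def changeCoords (v : Fin 3 → Vec) : Form →ₐ[ℂ] Form :=
  aeval fun j => ∑ i, C (v i j) * X i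

theorem changeCoords_isHomogeneous (v : Fin 3 → Vec) {n : ℕ} {F : Form}
    (hF : F.IsHomogeneous n) : (changeCoords v F).IsHomogeneous n := by
  have := hF.aeval (fun j => ∑ i, C (v i j) * X i : Fin 3 → Form) (n := 1) fun j =>
    IsHomogeneous.sum _ _ _ fun i _ => isHomogeneous_C_mul_X _ _
  rwa [one_mul] at this

theorem eval_changeCoords (v : Fin 3 → Vec) (F : Form) (x : Vec) :
    eval x (changeCoords v F) = eval (∑ i, x i • v i) F := by
  have h : (aeval x).comp (changeCoords v) = aeval (∑ i, x i • v i) := by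
    ext j
    simp [changeCoords, mul_comm]
  simpa using DFunLike.congr_fun h F

theorem eval_pderiv_changeCoords (v : Fin 3 → Vec) (F : Form) (x : Vec) (i : Fin 3) :
    eval x (pderiv i (changeCoords v F)) =
      v i ⬝ᵥ fun j => eval (∑ i, x i • v i) (pderiv j F) := by
  have h : ∀ G, eval x (aeval (fun j => ∑ i, C (v i j) * X i) G) = eval (∑ i, x i • v i) G :=
    fun G => eval_changeCoords v G x
  rw [changeCoords, pderiv_aeval_eq_sum, map_sum, dotProduct]
  refine Finset.sum_congr rfl fun j _ => ?_
  rw [map_mul, h, mul_comm]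
  congr 1
  simp [pderiv_X, Pi.single_apply]

theorem sum_smul_ne_zero {v : Fin 3 → Vec} (hv : LinearIndependent ℂ v) {x : Vec} (hx : x ≠ 0) :
    ∑ i, x i • v i ≠ 0 := fun h =>
  hx (funext (Fintype.linearIndependent_iff.1 hv x h))

/-- A pencil of cubics through eight points in general position has a singular member. -/
theorem GeneralPosition.exists_singular {P : Fin 8 → Plane} (hP : GeneralPosition P) :
    ∃ F : Form, F ≠ 0 ∧ F.IsHomogeneous 3 ∧ (∀ i, VanishesAt F (P i)) ∧
      ∃ x, IsSingularAt F x := by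
  -- a frame at a point over `P 0` provides coordinates in which `P 0` is `(1 : 0 : 0)`
  obtain ⟨Q, hQ⟩ := BlowUp.exists_f_eq P (P 0)
  obtain ⟨κ⟩ := BlowUp.Frame.nonempty hP.injective Q
  have hv := κ.linearIndependent
  set v := ![κ.p, κ.a, κ.b] with hvdef
  obtain ⟨c, c', hli, hc, hc'⟩ := exists_pencil P
  obtain ⟨e, he⟩ := exists_cubicForm_eq
    (changeCoords_isHomogeneous v (cubicForm_isHomogeneous c))
  obtain ⟨e', he'⟩ := exists_cubicForm_eq
    (changeCoords_isHomogeneous v (cubicForm_isHomogeneous c'))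
  obtain ⟨s, t, hst, hdisc⟩ := exists_tangentDiscr_eq_zero e e'
  have hF := cubicForm_isHomogeneous (s • c + t • c')
  have hF0 : cubicForm (s • c + t • c') ≠ 0 := by
    rw [Ne, map_eq_zero_iff _ cubicForm_injective]
    intro h
    obtain ⟨hs, ht⟩ := LinearIndependent.pair_iff.1 hli s t h
    simp [hs, ht] at hst
  have hFP : ∀ i, VanishesAt (cubicForm (s • c + t • c')) (P i) := fun i => by
    have h1 : eval (P i).rep (cubicForm c) = 0 := hc i
    have h2 : eval (P i).rep (cubicForm c') = 0 := hc' i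
    simp [VanishesAt, h1, h2, smul_eval]
  have hchange : cubicForm (s • e + t • e') = changeCoords v (cubicForm (s • c + t • c')) := by
    simp only [map_add, map_smul, he, he']
  refine ⟨_, hF0, hF, hFP, ?_⟩
  have he0 : (s • e + t • e') 0 = 0 := by
    have h1 : eval ![1, 0, 0] (cubicForm (s • e + t • e')) = 0 := by
      rw [hchange, eval_changeCoords]
      have h2 : ∑ i, (![1, 0, 0] : Vec) i • v i = κ.p := by
        simp [Fin.sum_univ_three, hvdef]
      rw [h2]
      refine (κ.vanishesAt_iff hF).1 ?_
      rw [hQ]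
      exact hFP 0
    simpa [eval_cubicForm] using h1
  rcases exists_singular_or_line he0 hdisc with ⟨x, hx0, hx⟩ | ⟨y, z, hyz, h⟩
  · refine ⟨Projectivization.mk ℂ _ (sum_smul_ne_zero hv hx0), ?_⟩
    rw [isSingularAt_mk hF (by norm_num)]
    rw [hchange] at hx
    refine congrFun (eq_zero_of_forall_dotProduct_eq_zero hv fun i => ?_)
    rw [← eval_pderiv_changeCoords]
    exact hx i
  · refine (not_irreducible_of_eval_line_eq_zero hF (x := κ.p) (y := y • κ.a + z • κ.b) ?_ ?_
      (hP.irreducible hF hF0 hFP)).elim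
    · rw [LinearIndependent.pair_iff]
      intro α β hαβ
      have h1 : ∑ i, (![α, β * y, β * z] : Vec) i • v i = 0 := by
        rw [← hαβ]
        simp [Fin.sum_univ_three, hvdef, mul_smul, add_assoc]
      have h2 := Fintype.linearIndependent_iff.1 hv _ h1
      refine ⟨h2 0, ?_⟩
      rcases hyz with hy | hz
      · exact (mul_eq_zero.1 (h2 1)).resolve_right hy
      · exact (mul_eq_zero.1 (h2 2)).resolve_right hz
    · intro α β
      rw [← h α β, hchange, eval_changeCoords]
      congr 2
      simp [Fin.sum_univ_three, hvdef, mul_smul, add_assoc]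

/-! ### Multiplicity of sections -/

namespace BlowUp

variable {r : ℕ} {P : Fin r → Plane}

namespace Frame

variable {Q : BlowUp P} (κ : Frame Q)

theorem isSingularAt_of_dotProduct_eq_zero {n : ℕ} {F : Form} (hF : F.IsHomogeneous n)
    (hn : n ≠ 0) (h : eval κ.p F = 0) (ha : κ.a ⬝ᵥ (fun j => eval κ.p (pderiv j F)) = 0)
    (hb : κ.b ⬝ᵥ (fun j => eval κ.p (pderiv j F)) = 0) : IsSingularAt F Q.f := by
  rw [κ.isSingularAt_iff hF hn]
  refine congrFun (eq_zero_of_forall_dotProduct_eq_zero κ.linearIndependent fun i => ?_)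
  fin_cases i
  · have h1 := congrArg (eval κ.p) hF.sum_X_mul_pderiv
    simpa [h, dotProduct] using h1
  · exact ha
  · exact hb

theorem eval_zero_pullback (F : Form) : eval 0 (κ.pullback F) = eval κ.p F := by
  have h : (aeval (0 : Fin 2 → ℂ)).comp κ.pullback = aeval κ.p := by
    ext j
    by_cases hQ : Q.IsExceptional <;> simp [pullback, chart, hQ]
  simpa using DFunLike.congr_fun h F

/-- Taylor's formula for the pull-back of a curve to the chart of a frame. -/
theorem pullback_sub_mem_sq (I : Ideal (MvPolynomial (Fin 2) ℂ))
    (hI : ∀ j, κ.chart j - C (κ.p j) ∈ I) (F : Form) :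
    κ.pullback F - (C (eval κ.p F) +
      ∑ j, (κ.chart j - C (κ.p j)) * C (eval κ.p (pderiv j F))) ∈ I ^ 2 := by
  have h := aeval_add_sub_mem_sq I (fun j => C (κ.p j)) _ hI F
  have h1 : ∀ G : Form, aeval (fun j => (C (κ.p j) : MvPolynomial (Fin 2) ℂ)) G =
      C (eval κ.p G) := by
    intro G
    have h2 : aeval (fun j => (C (κ.p j) : MvPolynomial (Fin 2) ℂ)) =
        (Algebra.ofId ℂ (MvPolynomial (Fin 2) ℂ)).comp (aeval κ.p) := by
      ext j
      simp [Algebra.ofId_apply, algebraMap_eq]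
    simpa [Algebra.ofId_apply, algebraMap_eq] using DFunLike.congr_fun h2 G
  simp only [h1, add_sub_cancel] at h
  exact h

theorem chart_sub_of_isExceptional (hQ : Q.IsExceptional) (j : Fin 3) :
    κ.chart j - C (κ.p j) = X 0 * (C (κ.a j) + X 1 * C (κ.b j)) := by
  simp [chart, hQ]

theorem chart_sub_of_not_isExceptional (hQ : ¬ Q.IsExceptional) (j : Fin 3) :
    κ.chart j - C (κ.p j) = X 0 * C (κ.a j) + X 1 * C (κ.b j) := by
  simp only [chart, hQ, if_false]
  ring

/-- On an exceptional curve `u = 0`, the pull-back of a curve through its centre is divisible by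
`u`, and the quotient restricts to the differential of the curve at the centre. -/
theorem exists_pullback_eq_of_isExceptional (hQ : Q.IsExceptional) {F : Form}
    (h : eval κ.p F = 0) : ∃ g, κ.pullback F =
      X 0 * (∑ j, (C (κ.a j) + X 1 * C (κ.b j)) * C (eval κ.p (pderiv j F)) + X 0 * g) := by
  have h1 := κ.pullback_sub_mem_sq (Ideal.span {X 0}) (fun j => by
    rw [κ.chart_sub_of_isExceptional hQ]
    exact Ideal.mul_mem_right _ _ (Ideal.mem_span_singleton_self _)) F
  rw [Ideal.span_singleton_pow, Ideal.mem_span_singleton] at h1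
  obtain ⟨g, hg⟩ := h1
  refine ⟨g, ?_⟩
  simp only [h, κ.chart_sub_of_isExceptional hQ, map_zero, zero_add, mul_assoc,
    ← Finset.mul_sum] at hg
  linear_combination hg

end Frame

theorem mem_sections_one_iff (hP : Function.Injective P) {F : Form} :
    F ∈ sections P 1 ↔ F.IsHomogeneous 3 ∧ ∀ i, VanishesAt F (P i) := by
  refine ⟨fun h => ⟨h.1, fun i => ?_⟩, fun h => ⟨h.1, fun Q κ => ?_⟩⟩
  · obtain ⟨Q, hQ⟩ := exists_f_eq P (P i)
    obtain ⟨κ⟩ := Frame.nonempty hP Q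
    have hexc : Q.IsExceptional := ⟨i, hQ⟩
    rw [← hQ, κ.vanishesAt_iff h.1, ← κ.eval_zero_pullback]
    have h1 := map_dvd (eval (0 : Fin 2 → ℂ)) (h.2 Q κ)
    simpa only [Frame.excEq, if_pos hexc, pow_one, eval_X, Pi.zero_apply, zero_dvd_iff] using h1
  · by_cases hexc : Q.IsExceptional
    · obtain ⟨i, hi⟩ := id hexc
      have h0 : eval κ.p F = 0 := by
        rw [← κ.vanishesAt_iff h.1, show Q.f = P i from hi]
        exact h.2 i
      obtain ⟨g, hg⟩ := κ.exists_pullback_eq_of_isExceptional hexc h0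
      rw [hg, Frame.excEq, if_pos hexc, pow_one]
      exact dvd_mul_right _ _
    · simp [Frame.excEq, hexc]

/-- Off the exceptional curves the blow-down is a local isomorphism, so that a section of
multiplicity two comes from a singular curve. A section that is singular at a point of an
exceptional curve also comes from a curve that is
singular at the centre, because it restricts to the exceptional curve as the differential of the
curve at the centre. -/
theorem isSingularAt_of_multGE_two {n : ℕ} (hn : n ≠ 0) (hP : Function.Injective P)
    {Q : BlowUp P} {F : Form} (hF : F.IsHomogeneous n) (h : MultGE 1 2 Q F) :
    IsSingularAt F Q.f := by
  obtain ⟨κ⟩ := Frame.nonempty hP Q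
  obtain ⟨g, hg, hgF⟩ := h κ
  obtain ⟨hg0, hg1⟩ := eval_eq_zero_of_mem_sq hg
  by_cases hexc : Q.IsExceptional
  · rw [Frame.excEq, if_pos hexc, pow_one] at hgF
    have h0 : eval κ.p F = 0 := by
      rw [← κ.eval_zero_pullback, hgF]
      simp
    obtain ⟨g', hg'⟩ := κ.exists_pullback_eq_of_isExceptional hexc h0
    rw [hgF] at hg'
    have hgg := mul_left_cancel₀ (X_ne_zero _) hg'
    refine κ.isSingularAt_of_dotProduct_eq_zero hF hn h0 ?_ ?_
    · rw [hgg] at hg0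
      simpa [dotProduct, -eval_zero, -eval_zero'] using hg0
    · have h2 := hg1 1
      rw [hgg] at h2
      simpa [dotProduct, pderiv_X, mul_comm, -eval_zero, -eval_zero'] using h2
  · rw [Frame.excEq, if_neg hexc, one_pow, one_mul] at hgF
    have hd : ∀ i, ∑ j, eval 0 (κ.pullback (pderiv j F)) * eval 0 (pderiv i (κ.chart j)) = 0 := by
      intro i
      rw [← hg1 i, ← hgF, Frame.pullback, pderiv_aeval_eq_sum, map_sum]
      simp only [map_mul]
    simp only [κ.eval_zero_pullback, Frame.chart, if_neg hexc] at hd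
    refine κ.isSingularAt_of_dotProduct_eq_zero hF hn ?_ ?_ ?_
    · rw [← κ.eval_zero_pullback, hgF, hg0]
    · have h2 := hd 0
      simpa [dotProduct, pderiv_X, mul_comm, -eval_zero, -eval_zero'] using h2
    · have h2 := hd 1
      simpa [dotProduct, pderiv_X, mul_comm, -eval_zero, -eval_zero'] using h2

theorem multGE_two_of_isSingularAt {n : ℕ} (hn : n ≠ 0) {Q : BlowUp P} {F : Form}
    (hF : F.IsHomogeneous n) (hQ : ¬ Q.IsExceptional) (h : IsSingularAt F Q.f) :
    MultGE 1 2 Q F := by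
  intro κ
  refine ⟨κ.pullback F, ?_, by simp [Frame.excEq, hQ]⟩
  have h1 := κ.pullback_sub_mem_sq κ.maxIdeal (fun j => by
    rw [κ.chart_sub_of_not_isExceptional hQ]
    exact add_mem (Ideal.mul_mem_right _ _ (Ideal.subset_span (by simp)))
      (Ideal.mul_mem_right _ _ (Ideal.subset_span (by simp)))) F
  simpa [(κ.vanishesAt_iff hF).1 h.1, (κ.isSingularAt_iff hF hn).1 h] using h1

theorem multGE_mono {d m m' : ℕ} (hm : m ≤ m') {Q : BlowUp P} {F : Form} (h : MultGE d m' Q F) :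
    MultGE d m Q F := fun κ =>
  let ⟨g, hg, hgF⟩ := h κ
  ⟨g, Ideal.pow_le_pow_right hm hg, hgF⟩

/-! ### The initial degree -/

/-- A nonzero constant vanishes at no point. -/
theorem fatSections_zero_eq_bot (hP : Function.Injective P) {Z : Set (BlowUp P)} (hZ : Z.Nonempty)
    {m : ℕ} (hm : m ≠ 0) : fatSections Z 0 m = ⊥ := by
  rw [Submodule.eq_bot_iff]
  rintro F ⟨hF, hFZ⟩
  obtain ⟨Q, hQ⟩ := hZ
  obtain ⟨κ⟩ := Frame.nonempty hP Q
  obtain ⟨g, hg, hgF⟩ := hFZ Q hQ κ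
  rw [pow_zero, one_mul] at hgF
  have hg0 : eval 0 g = 0 := by
    obtain ⟨x, y, rfl⟩ := Ideal.mem_span_pair.1 (Ideal.pow_le_self hm hg)
    simp
  have hdeg : F.totalDegree = 0 := (totalDegree_zero_iff_isHomogeneous _).2 hF.1
  rw [totalDegree_eq_zero_iff_eq_C] at hdeg
  rw [← hgF, κ.eval_zero_pullback, hdeg, eval_C] at hg0
  rw [hdeg, hg0, map_zero]

theorem fatSections_empty_zero_ne_bot (m : ℕ) :
    fatSections (∅ : Set (BlowUp P)) 0 m ≠ ⊥ := by
  rw [Submodule.ne_bot_iff]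
  exact ⟨1, ⟨⟨isHomogeneous_one _ _, fun Q κ => by simp⟩, by simp⟩, one_ne_zero⟩

theorem alpha_eq_one_iff {m : ℕ} {Z : Set (BlowUp P)} :
    alpha m Z = 1 ↔ fatSections Z 0 m = ⊥ ∧ fatSections Z 1 m ≠ ⊥ := by
  constructor
  · intro h
    constructor
    · by_contra h0
      have : alpha m Z ≤ 0 := sInf_le ⟨0, by simp, h0⟩
      rw [h] at this
      simp at this
    · have hne : {n : ℕ∞ | ∃ d : ℕ, n = d ∧ fatSections Z d m ≠ ⊥}.Nonempty := by
        by_contra hne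
        rw [Set.not_nonempty_iff_eq_empty] at hne
        rw [alpha, hne, sInf_empty] at h
        simp at h
      obtain ⟨d, hd, hd'⟩ := csInf_mem hne
      have h1 : (1 : ℕ∞) = d := h.symm.trans hd
      have h2 : d = 1 := by exact_mod_cast h1.symm
      rwa [h2] at hd'
  · rintro ⟨h0, h1⟩
    refine le_antisymm (sInf_le ⟨1, by simp, h1⟩) (le_sInf ?_)
    rintro n ⟨d, rfl, hd⟩
    have : d ≠ 0 := fun h => hd (h ▸ h0)
    exact_mod_cast Nat.one_le_iff_ne_zero.2 this

end BlowUp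

namespace GeneralPosition

open BlowUp

variable {P : Fin 8 → Plane}

theorem ne_of_isSingularAt (hP : GeneralPosition P) {F : Form} (hF : F.IsHomogeneous 3)
    (hF0 : F ≠ 0) (hFP : ∀ i, VanishesAt F (P i)) {x : Plane} (hx : IsSingularAt F x) (i : Fin 8) :
    x ≠ P i := by
  rintro rfl
  exact hP.no_cubic_singular_at i ⟨F, hF0, hF, hFP, hx⟩

theorem singularPoints_eq_singleton (hP : GeneralPosition P) {F : Form} (hF : F.IsHomogeneous 3)
    (hF0 : F ≠ 0) (hFP : ∀ i, VanishesAt F (P i)) {x : Plane} (hx : IsSingularAt F x) :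
    singularPoints F = {x} :=
  Set.eq_singleton_iff_unique_mem.2 ⟨hx, fun _ hy =>
    eq_of_isSingularAt hF (hP.irreducible hF hF0 hFP) hy hx⟩

theorem alpha_eq_one_and_alpha_two_eq_one_iff (hP : GeneralPosition P) (Z : Set (BlowUp P)) :
    (alpha 1 Z = 1 ∧ alpha 2 Z = 1) ↔ ∃ Q : BlowUp P, Z = {Q} ∧
      ∃ F : Form, F.IsHomogeneous 3 ∧ Irreducible F ∧ (∀ i, VanishesAt F (P i)) ∧
        singularPoints F = {Q.f} ∧ ∀ i, Q.f ≠ P i := by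
  rw [alpha_eq_one_iff, alpha_eq_one_iff]
  constructor
  · rintro ⟨⟨hZ, -⟩, -, h2⟩
    have hZ' : Z.Nonempty := by
      rw [Set.nonempty_iff_ne_empty]
      rintro rfl
      exact fatSections_empty_zero_ne_bot 1 hZ
    obtain ⟨F, ⟨hFs, hFZ⟩, hF0⟩ := Submodule.ne_bot_iff _ |>.1 h2
    obtain ⟨hF, hFP⟩ := (mem_sections_one_iff hP.injective).1 hFs
    have hirr := hP.irreducible hF hF0 hFP
    have hZs : ∀ Q ∈ Z, IsSingularAt F Q.f := fun Q hQ =>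
      isSingularAt_of_multGE_two three_ne_zero hP.injective hF (hFZ Q hQ)
    obtain ⟨Q, hQ⟩ := hZ'
    have hQP := hP.ne_of_isSingularAt hF hF0 hFP (hZs Q hQ)
    refine ⟨Q, Set.eq_singleton_iff_unique_mem.2 ⟨hQ, fun Q' hQ' => Eq.symm ?_⟩, F, hF, hirr,
      hFP, hP.singularPoints_eq_singleton hF hF0 hFP (hZs Q hQ), hQP⟩
    exact eq_of_f_eq (eq_of_isSingularAt hF hirr (hZs Q hQ) (hZs Q' hQ'))
      fun ⟨i, hi⟩ => hQP i hi
  · rintro ⟨Q, rfl, F, hF, hirr, hFP, hFs, hQP⟩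
    have hQ : Q.f ∈ singularPoints F := hFs ▸ Set.mem_singleton _
    have hmem : F ∈ fatSections {Q} 1 2 := by
      refine ⟨(mem_sections_one_iff hP.injective).2 ⟨hF, hFP⟩, ?_⟩
      rintro _ rfl
      exact multGE_two_of_isSingularAt three_ne_zero hF (fun ⟨i, hi⟩ => hQP i hi) hQ
    have hmem' : F ∈ fatSections {Q} 1 1 :=
      ⟨hmem.1, fun Q' hQ' => multGE_mono one_le_two (hmem.2 Q' hQ')⟩
    exact ⟨⟨fatSections_zero_eq_bot hP.injective (Set.singleton_nonempty Q) one_ne_zero,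
      (Submodule.ne_bot_iff _).2 ⟨F, hmem', hirr.ne_zero⟩⟩,
      fatSections_zero_eq_bot hP.injective (Set.singleton_nonempty Q) two_ne_zero,
      (Submodule.ne_bot_iff _).2 ⟨F, hmem, hirr.ne_zero⟩⟩

theorem exists_irreducible_singular (hP : GeneralPosition P) :
    ∃ Q : BlowUp P, ∃ F : Form, F.IsHomogeneous 3 ∧ Irreducible F ∧
      (∀ i, VanishesAt F (P i)) ∧ singularPoints F = {Q.f} ∧ ∀ i, Q.f ≠ P i := by
  obtain ⟨F, hF0, hF, hFP, x, hx⟩ := hP.exists_singular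
  obtain ⟨Q, rfl⟩ := exists_f_eq P x
  exact ⟨Q, F, hF, hP.irreducible hF hF0 hFP, hFP,
    hP.singularPoints_eq_singleton hF hF0 hFP hx, hP.ne_of_isSingularAt hF hF0 hFP hx⟩

end GeneralPosition

end DelPezzo

theorem mainTheorem2 (P : Fin 8 → DelPezzo.Plane) (hP : DelPezzo.GeneralPosition P) :
    (∀ Z : Set (DelPezzo.BlowUp P),
      (DelPezzo.BlowUp.alpha 1 Z = 1 ∧ DelPezzo.BlowUp.alpha 2 Z = 1) ↔
        ∃ Q : DelPezzo.BlowUp P, Z = {Q} ∧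
          ∃ F : DelPezzo.Form, F.IsHomogeneous 3 ∧ Irreducible F ∧
            (∀ i, DelPezzo.VanishesAt F (P i)) ∧
            DelPezzo.singularPoints F = {Q.f} ∧ ∀ i, Q.f ≠ P i) ∧
    ∃ Q : DelPezzo.BlowUp P, ∃ F : DelPezzo.Form, F.IsHomogeneous 3 ∧ Irreducible F ∧
      (∀ i, DelPezzo.VanishesAt F (P i)) ∧
      DelPezzo.singularPoints F = {Q.f} ∧ ∀ i, Q.f ≠ P i :=
  ⟨hP.alpha_eq_one_and_alpha_two_eq_one_iff, hP.exists_irreducible_singular⟩
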